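/- **Theorem 2.1.** Let $(E,\mathscr E,\mu)$ be a $\sigma$-finite measure space, $p\in[1,\infty)$, $X=L^p(E,\mathscr E,\mu)$ the space of real-valued $p$-integrable functions (weighted $L^p$ spaces with a positive measurable weight are included, the weight being absorbed in $\mu$), $X_+$ the cone of almost everywhere nonnegative functions in $X$, $X'$ the dual of $X$ and $X'_+$ the cone of those $\phi\in X'$ with $\langle\phi,f\rangle\ge 0$ for all $f\in X_+$. A bounded operator $T$ on $X$ is extended to the space $X_{\mathbb C}$ of complex-valued functions in $L^p$ by $T(g+ih)=Tg+iTh$; its spectrum $\sigma(T)\subset\mathbb C$, its point spectrum $\sigma_p(T)=\{\lambda\in\mathbb C:\ \lambda-T \text{ is not injective}\}$ and its resolvent $(\lambda-T)^{-1}$ are those of this extension, and $r(T)=\sup\{|\lambda|:\lambda\in\sigma(T)\}$ is its spectral radius. An operator $T$ is power compact if $T^\ell$ is compact for some integer $\ell\ge1$. Let $U:X\to X$ be a bounded linear operator which is positive, i.e. $U(X_+)\subset X_+$, with $r(U)>0$. Assume that $U=W+K$ with bounded linear operators $W,K:X\to X$ such that $\|W\|<r(U)$ and such that $K(\lambda-W)^{-1}$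 is power compact for every $\lambda\in\mathbb C$ with $|\lambda|>\|W\|$. Then (i) there exist $f_0\in X_+\setminus\{0\}$ and $\phi_0\in X'_+\setminus\{0\}$ such that $Uf_0=r(U)f_0$ and $U^*\phi_0=r(U)\phi_0$, where $U^*:X'\to X'$ is the dual operator of $U$; (ii) for every $\kappa$ with $\|W\|<\kappa<r(U)$, the set $\sigma(U)\cap\{\lambda\in\mathbb C:|\lambda|\ge\kappa\}$ is finite and contained in $\sigma_p(U)$. -/

import Mathlib

open MeasureTheory
open scoped ENNReal

namespace PosLp

section

variable {E : Type*} [MeasurableSpace E] {p : ℝ≥0∞} {μ : Measure E}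

/-- Real part `X_ℂ → X_ℝ`, `f = g + i h ↦ g`, for `X = L^p(μ)`. -/
noncomputable def re [Fact (1 ≤ p)] : Lp ℂ p μ →L[ℝ] Lp ℝ p μ :=
  Complex.reCLM.compLpL p μ

/-- Imaginary part `X_ℂ → X_ℝ`, `f = g + i h ↦ h`. -/
noncomputable def im [Fact (1 ≤ p)] : Lp ℂ p μ →L[ℝ] Lp ℝ p μ :=
  Complex.imCLM.compLpL p μ

/-- The inclusion `X_ℝ → X_ℂ` of real functions into complex functions. -/
noncomputable def incl [Fact (1 ≤ p)] : Lp ℝ p μ →L[ℝ] Lp ℂ p μ :=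
  Complex.ofRealCLM.compLpL p μ

theorem coeFn_re [Fact (1 ≤ p)] (f : Lp ℂ p μ) : ∀ᵐ x ∂μ, re f x = (f x).re :=
  Complex.reCLM.coeFn_compLp f

theorem coeFn_im [Fact (1 ≤ p)] (f : Lp ℂ p μ) : ∀ᵐ x ∂μ, im f x = (f x).im :=
  Complex.imCLM.coeFn_compLp f

theorem coeFn_incl [Fact (1 ≤ p)] (f : Lp ℝ p μ) : ∀ᵐ x ∂μ, incl f x = (f x : ℂ) :=
  Complex.ofRealCLM.coeFn_compLp f

theorem re_smul [Fact (1 ≤ p)] (c : ℂ) (f : Lp ℂ p μ) :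
    re (c • f) = c.re • re f - c.im • im f := by
  apply Lp.ext
  filter_upwards [coeFn_re (c • f), coeFn_re f, coeFn_im f, Lp.coeFn_smul c f,
    Lp.coeFn_sub (c.re • re f) (c.im • im f), Lp.coeFn_smul c.re (re f),
    Lp.coeFn_smul c.im (im f)] with x h1 h2 h3 h4 h5 h6 h7
  rw [h1, h4, h5, Pi.sub_apply, h6, h7, Pi.smul_apply, Pi.smul_apply, Pi.smul_apply, h2, h3]
  simp

theorem im_smul [Fact (1 ≤ p)] (c : ℂ) (f : Lp ℂ p μ) :
    im (c • f) = c.re • im f + c.im • re f := by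
  apply Lp.ext
  filter_upwards [coeFn_im (c • f), coeFn_re f, coeFn_im f, Lp.coeFn_smul c f,
    Lp.coeFn_add (c.re • im f) (c.im • re f), Lp.coeFn_smul c.re (im f),
    Lp.coeFn_smul c.im (re f)] with x h1 h2 h3 h4 h5 h6 h7
  rw [h1, h4, h5, Pi.add_apply, h6, h7, Pi.smul_apply, Pi.smul_apply, Pi.smul_apply, h2, h3]
  simp

theorem real_smul_eq [Fact (1 ≤ p)] (a : ℝ) (f : Lp ℂ p μ) : a • f = (a : ℂ) • f := by
  apply Lp.ext
  filter_upwards [Lp.coeFn_smul a f, Lp.coeFn_smul (a : ℂ) f] with x h1 h2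
  rw [h1, h2]
  simp

/-- The complex-linear extension to `X_ℂ` of a bounded operator `U` on the real space `X`,
`g + i h ↦ U g + i U h`. -/
noncomputable def complexify [Fact (1 ≤ p)] (U : Lp ℝ p μ →L[ℝ] Lp ℝ p μ) :
    Lp ℂ p μ →L[ℂ] Lp ℂ p μ where
  toFun f := incl (U (re f)) + Complex.I • incl (U (im f))
  map_add' f g := by
    simp only [map_add, smul_add]
    abel
  map_smul' c f := by
    simp only [re_smul, im_smul, map_add, map_sub, map_smul, RingHom.id_apply, real_smul_eq]
    match_scalars
    · linear_combination Complex.re_add_im c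
    · linear_combination (-(c.im : ℂ)) * Complex.I_sq + Complex.I * Complex.re_add_im c
  cont := by fun_prop

/-- The spectral radius `r(U) = sup {|z| : z ∈ σ(U)}`, a real number; the spectrum of an operator
on the real space `X` is that of its extension to `X_ℂ`. -/
noncomputable def specRadius [Fact (1 ≤ p)] (U : Lp ℝ p μ →L[ℝ] Lp ℝ p μ) : ℝ :=
  (spectralRadius ℂ (complexify U)).toReal

/-- `U ≥ 0`: the operator maps nonnegative functions to nonnegative functions. -/
def IsPositiveOp [Fact (1 ≤ p)] (U : Lp ℝ p μ →L[ℝ] Lp ℝ p μ) : Prop :=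
  ∀ f : Lp ℝ p μ, 0 ≤ f → 0 ≤ U f

/-- `φ ∈ X'_+`: the functional is nonnegative on nonnegative functions. -/
def IsPositiveFunctional [Fact (1 ≤ p)] (φ : StrongDual ℝ (Lp ℝ p μ)) : Prop :=
  ∀ f : Lp ℝ p μ, 0 ≤ f → 0 ≤ φ f

/-- The dual operator `U* : X' → X'`, `⟨U* φ, f⟩ = ⟨φ, U f⟩`. -/
noncomputable def dualOp [Fact (1 ≤ p)] (U : Lp ℝ p μ →L[ℝ] Lp ℝ p μ) :
    StrongDual ℝ (Lp ℝ p μ) →L[ℝ] StrongDual ℝ (Lp ℝ p μ) :=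
  ContinuousLinearMap.precomp ℝ U

end

/-- `T` is power compact: some power `T ^ l`, `l ≥ 1`, is a compact operator. -/
def IsPowerCompact {X : Type*} [NormedAddCommGroup X] [NormedSpace ℂ X] (T : X →L[ℂ] X) : Prop :=
  ∃ l : ℕ, 1 ≤ l ∧ IsCompactOperator (T ^ l)

/-- The point spectrum: all `z` for which `z - T` is not injective. -/
def pointSpectrum {X : Type*} [NormedAddCommGroup X] [NormedSpace ℂ X] (T : X →L[ℂ] X) : Set ℂ :=
  {z : ℂ | ¬ Function.Injective (z • ContinuousLinearMap.id ℂ X - T)}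

end PosLp

/-! For `|z| > ‖W‖` the factorization `z - U = (1 - K(z - W)⁻¹)(z - W)` has an invertible right
factor, so Riesz theory for power compact operators controls `z - U`. The Fredholm alternative
(`isUnit_one_sub_of_injective`) turns spectrum there into eigenvalues. Adding a finite rank operator
makes `z - U` invertible (`exists_finiteRank_isUnit`), so locally the resolvent is an analytic
operator function divided by a scalar determinant (`exists_resolvent_eq_quotient`). The spectrum is
therefore locally either everything or isolated points; connectedness of a ray to infinity excludes
the former, and compactness gives finiteness.

Positivity enters through the Neumann series: `‖(z - U)⁻¹‖ ≤ 8 ‖(|z| - U)⁻¹‖` for `|z| > r(U)`,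
which forces `r(U)` into the spectrum (`specRadius_mem_spectrum`). It is then a pole, whose leading
coefficient `Q ≠ 0` is a limit of positive operators and satisfies `UQ = QU = r(U)Q`. Eigenvectors
are `f₀ = Qf` and `φ₀ = ψ ∘ Q` with `f ≥ 0`, `ψ ≥ 0` and `ψ(Qf) > 0`. -/

namespace PosLp

/-! ### Riesz theory of power compact operators. -/

section PowerCompact

open Filter Topology

variable {X : Type*} [NormedAddCommGroup X] [NormedSpace ℂ X]

/-- The image of a bounded sequence under a compact operator is not uniformly separated. -/
theorem not_pairwise_separated {C : X →L[ℂ] X} (hC : IsCompactOperator C) {y : ℕ → X} {R : ℝ}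
    (hy : ∀ n, ‖y n‖ ≤ R) : ¬ ∀ m n, m < n → 1 ≤ ‖C (y n) - C (y m)‖ := by
  intro h
  obtain ⟨S, hS, hS'⟩ := hC.image_closedBall_subset_compact R
  obtain ⟨z, -, ψ, hψ, hz⟩ := hS.tendsto_subseq (fun n ↦ hS' ⟨y n, by simp [hy], rfl⟩)
  obtain ⟨N, hN⟩ := Metric.cauchySeq_iff'.1 hz.cauchySeq 1 one_pos
  have := hN (N + 1) (Nat.le_succ N)
  rw [dist_eq_norm] at this
  exact this.not_ge (h _ _ (hψ (Nat.lt_succ_self N)))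

theorem one_sub_pow_apply (T : X →L[ℂ] X) (l : ℕ) (x : X) :
    (∑ i ∈ Finset.range l, T ^ i) ((1 - T) x) = x - (T ^ l) x := by
  have := congrArg (fun S : X →L[ℂ] X ↦ S x) (geom_sum_mul_neg T l)
  simpa using this

/-- If `T` is power compact, the kernels of the powers of `1 - T` become stationary. -/
theorem exists_ker_pow_eq {T : X →L[ℂ] X} (hT : IsPowerCompact T) :
    ∃ m : ℕ, ∀ x, ((1 - T) ^ (m + 1)) x = 0 → ((1 - T) ^ m) x = 0 := by
  obtain ⟨l, -, hl⟩ := hT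
  by_contra! h
  set A : X →L[ℂ] X := 1 - T with hA
  -- Riesz's lemma for `ker A^n` inside the strictly larger `ker A^(n+1)`; the bound 3 is any number
  -- above `‖(2 : ℂ)‖`.
  have hstep : ∀ n, ∃ y, (A ^ (n + 1)) y = 0 ∧ ‖y‖ ≤ 3 ∧
      ∀ w, (A ^ n) w = 0 → 1 ≤ ‖y - w‖ := by
    intro n
    obtain ⟨x, hx, hx'⟩ := h n
    let V : Submodule ℂ X := (A ^ (n + 1)).ker
    let F : Submodule ℂ V := ((A ^ n).comp V.subtypeL).ker
    have hF : IsClosed (F : Set V) := ((A ^ n).comp V.subtypeL).isClosed_ker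
    obtain ⟨y, hy, hyw⟩ := riesz_lemma_of_norm_lt (c := (2 : ℂ)) (by norm_num) (R := 3)
      (by norm_num) hF ⟨⟨x, hx⟩, fun hh ↦ hx' hh⟩
    refine ⟨y, y.2, hy, fun w hw ↦ ?_⟩
    have hwV : w ∈ V := by
      change (A ^ (n + 1)) w = 0
      rw [pow_succ', mul_apply_eq_comp, hw, map_zero]
    exact hyw ⟨w, hwV⟩ hw
  choose y hy hyR hyw using hstep
  refine not_pairwise_separated hl hyR fun m n hmn ↦ ?_
  set S : X →L[ℂ] X := ∑ i ∈ Finset.range l, T ^ i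
  have hS : ∀ x, (T ^ l) x = x - S (A x) := fun x ↦ by
    rw [hA, one_sub_pow_apply]; abel
  have hcomm : Commute S A :=
    Commute.sum_left _ _ _ fun i _ ↦ ((Commute.one_right _).sub_right (Commute.refl T)).pow_left i
  have hSA : ∀ k x, (A ^ k) (S x) = S ((A ^ k) x) := fun k x ↦ by
    rw [← mul_apply_eq_comp, ← (hcomm.pow_right k).eq, mul_apply_eq_comp]
  have hle : ∀ x, (A ^ (m + 1)) x = 0 → (A ^ n) x = 0 := fun x hx ↦ by
    obtain ⟨k, rfl⟩ := Nat.exists_eq_add_of_le hmn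
    rw [add_comm, pow_add, mul_apply_eq_comp, hx, map_zero]
  have hm := hle _ (hy m)
  have hAA : ∀ x, (A ^ n) (A x) = (A ^ (n + 1)) x := fun x ↦ by
    rw [pow_succ, mul_apply_eq_comp]
  -- Since `T^l = 1 - SA`, the difference `T^l y_n - T^l y_m` is `y_n` minus this vector, which lies
  -- in `ker A^n`.
  have key := hyw n (S (A (y n)) + (y m - S (A (y m)))) (by
    rw [map_add, map_sub, hSA, hSA, hAA, hAA, hy, pow_succ', mul_apply_eq_comp, hm]
    simp)
  rw [hS, hS]
  convert key using 2
  abel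

/-- If `T` is power compact, the kernels of the powers of `1 - T` are finite-dimensional. -/
theorem finiteDimensional_ker_pow {T : X →L[ℂ] X} (hT : IsPowerCompact T) (m : ℕ) :
    FiniteDimensional ℂ ((1 - T) ^ m).ker := by
  obtain ⟨l, -, hl⟩ := hT
  let N : Submodule ℂ X := ((1 - T) ^ m).ker
  -- `C = 1 - (1 - T^l)^m` is a multiple of `T^l`, hence compact; as `1 - T` divides `1 - T^l`, it
  -- is the identity on `ker (1 - T)^m`.
  let C : X →L[ℂ] X := (∑ i ∈ Finset.range m, (1 - T ^ l) ^ i) * T ^ l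
  have hC : IsCompactOperator C := hl.clm_comp _
  have hCN : ∀ x ∈ N, C x = x := by
    intro x hx
    have h1 : C = 1 - (1 - T ^ l) ^ m := by
      rw [← geom_sum_mul_neg, sub_sub_cancel]
    have hx' : ((1 - T) ^ m) x = 0 := hx
    have hcomm : Commute (∑ i ∈ Finset.range l, T ^ i) (1 - T) :=
      Commute.sum_left _ _ _ fun i _ ↦
        ((Commute.one_right _).sub_right (Commute.refl T)).pow_left i
    rw [h1, ← geom_sum_mul_neg T l, hcomm.mul_pow, sub_apply, mul_apply_eq_comp, hx']
    simp
  have hN : IsClosed (N : Set X) := ((1 - T) ^ m).isClosed_ker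
  have h2 : IsCompactOperator ((C : X →ₗ[ℂ] X).restrict (p := N) (q := N)
      fun x hx ↦ by simpa [hCN x hx] using hx) :=
    IsCompactOperator.restrict (f := (C : X →ₗ[ℂ] X)) hC _ hN
  apply FiniteDimensional.of_isCompactOperator_id (𝕜 := ℂ)
  have h3 : (id : N → N) = (C : X →ₗ[ℂ] X).restrict (p := N) (q := N)
      (fun x hx ↦ by simpa [hCN x hx] using hx) :=
    funext fun x ↦ Subtype.ext (hCN x x.2).symm
  exact h3 ▸ h2

/-- If `T` is power compact and `1 - T` is injective, then `1 - T` is bounded below. -/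
theorem antilipschitz_one_sub {T : X →L[ℂ] X} (hT : IsPowerCompact T)
    (hinj : Function.Injective (1 - T : X →L[ℂ] X)) :
    ∃ c, AntilipschitzWith c (1 - T : X →L[ℂ] X) := by
  obtain ⟨l, -, hl⟩ := hT
  rw [antilipschitzWith_iff_exists_mul_le_norm]
  by_contra! h
  have hstep : ∀ n : ℕ, ∃ x : X, ‖x‖ = 1 ∧ ‖(1 - T : X →L[ℂ] X) x‖ < 1 / ((n : ℝ) + 1) := by
    intro n
    obtain ⟨x, hx⟩ := h (1 / ((n : ℝ) + 1)) (by positivity)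
    have hx0 : x ≠ 0 := by rintro rfl; simp at hx
    have hpos : 0 < ‖x‖ := norm_pos_iff.2 hx0
    refine ⟨((‖x‖⁻¹ : ℝ) : ℂ) • x, by simp [norm_smul, hpos.ne'], ?_⟩
    rw [map_smul, norm_smul, Complex.norm_real, norm_inv, norm_norm, inv_mul_lt_iff₀ hpos, mul_comm]
    exact hx
  choose x hx1 hx using hstep
  have hlim : Tendsto (fun n ↦ (1 - T : X →L[ℂ] X) (x n)) atTop (𝓝 0) :=
    squeeze_zero_norm (fun n ↦ (hx n).le) tendsto_one_div_add_atTop_nhds_zero_nat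
  obtain ⟨S, hS, hS'⟩ := hl.image_closedBall_subset_compact 1
  obtain ⟨z, -, ψ, hψ, hz⟩ := hS.tendsto_subseq (fun n ↦ hS' ⟨x n, by simp [hx1], rfl⟩)
  -- `x = S(1 - T)x + T^l x` with `S` the geometric sum: the first term tends to 0, the second
  -- converges along `ψ`.
  have hxz : Tendsto (fun n ↦ x (ψ n)) atTop (𝓝 z) := by
    have h1 := (((∑ i ∈ Finset.range l, T ^ i).continuous.tendsto 0).comp hlim).comp
      hψ.tendsto_atTop
    rw [map_zero] at h1
    have h2 := h1.add hz
    rw [zero_add] at h2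
    refine h2.congr fun n ↦ ?_
    simp only [Function.comp_apply]
    rw [one_sub_pow_apply]
    exact sub_add_cancel _ _
  have hz1 : ‖z‖ = 1 := tendsto_nhds_unique hxz.norm (by simp [hx1])
  have hz0 : (1 - T : X →L[ℂ] X) z = 0 :=
    tendsto_nhds_unique (((1 - T : X →L[ℂ] X).continuous.tendsto z).comp hxz)
      (hlim.comp hψ.tendsto_atTop)
  have : z = 0 := hinj (by rw [hz0, map_zero])
  simp [this] at hz1

/-- **Fredholm alternative** for power compact operators. -/
theorem isUnit_one_sub_of_injective [CompleteSpace X] {T : X →L[ℂ] X} (hT : IsPowerCompact T)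
    (hinj : Function.Injective (1 - T : X →L[ℂ] X)) : IsUnit (1 - T) := by
  rw [ContinuousLinearMap.isUnit_iff_bijective]
  refine ⟨hinj, ?_⟩
  obtain ⟨c, hc⟩ := antilipschitz_one_sub hT hinj
  obtain ⟨l, -, hl⟩ := hT
  by_contra hsurj
  set A : X →L[ℂ] X := 1 - T with hA
  -- Bounded below, `A` is a closed map, so the decreasing ranges of `A^n` are closed. They decrease
  -- strictly if `A` is injective but not onto, and Riesz's lemma applies to them as it does to
  -- kernels.
  have hclosed : ∀ n : ℕ, IsClosed (Set.range (A ^ n : X →L[ℂ] X)) := by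
    intro n
    induction n with
    | zero => simp
    | succ n ih =>
      have : Set.range (A ^ (n + 1) : X →L[ℂ] X) = A '' Set.range (A ^ n : X →L[ℂ] X) := by
        rw [pow_succ', ← Set.range_comp]; rfl
      rw [this]
      exact (hc.isClosedEmbedding A.uniformContinuous).isClosedMap _ ih
  have hpinj : ∀ n : ℕ, Function.Injective (A ^ n : X →L[ℂ] X) := fun n ↦ by
    rw [FunLike.coe_pow_eq_iterate]
    exact hinj.iterate n
  obtain ⟨v, hv⟩ : ∃ v, ∀ x, A x ≠ v := by
    simpa [Function.Surjective] using hsurj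
  have hstep : ∀ n : ℕ, ∃ y, y ∈ Set.range (A ^ n : X →L[ℂ] X) ∧ ‖y‖ ≤ 3 ∧
      ∀ w ∈ Set.range (A ^ (n + 1) : X →L[ℂ] X), 1 ≤ ‖y - w‖ := by
    intro n
    let V : Submodule ℂ X := (A ^ n).range
    let F : Submodule ℂ V := (A ^ (n + 1)).range.comap V.subtype
    have hF : IsClosed (F : Set V) := (hclosed (n + 1)).preimage continuous_subtype_val
    obtain ⟨y, hy, hyw⟩ := riesz_lemma_of_norm_lt (c := (2 : ℂ)) (by norm_num) (R := 3)
      (by norm_num) hF ⟨⟨(A ^ n) v, v, rfl⟩, by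
        rintro ⟨u, hu⟩
        have hu' : (A ^ (n + 1)) u = (A ^ n) v := hu
        rw [pow_succ, mul_apply_eq_comp] at hu'
        exact hv u (hpinj n hu')⟩
    refine ⟨y, y.2, hy, ?_⟩
    rintro w ⟨u, rfl⟩
    have hwV : (A ^ (n + 1)) u ∈ V := ⟨A u, by
      change (A ^ n) (A u) = _
      rw [pow_succ, mul_apply_eq_comp]⟩
    exact hyw ⟨_, hwV⟩ ⟨u, rfl⟩
  choose y hy hyR hyw using hstep
  refine not_pairwise_separated hl hyR fun m n hmn ↦ ?_
  set S : X →L[ℂ] X := ∑ i ∈ Finset.range l, T ^ i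
  have hS : ∀ x, (T ^ l) x = x - S (A x) := fun x ↦ by
    rw [hA, one_sub_pow_apply]; abel
  have hcomm : Commute S A :=
    Commute.sum_left _ _ _ fun i _ ↦ ((Commute.one_right _).sub_right (Commute.refl T)).pow_left i
  have hSA : ∀ k x, S ((A ^ k) x) = (A ^ k) (S x) := fun k x ↦ by
    rw [← mul_apply_eq_comp, (hcomm.pow_right k).eq, mul_apply_eq_comp]
  obtain ⟨k, rfl⟩ := Nat.exists_eq_add_of_le hmn
  obtain ⟨u, hu⟩ := hy m
  obtain ⟨w, hw⟩ := hy (m + 1 + k)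
  have hAA : ∀ (j : ℕ) x, A ((A ^ j) x) = (A ^ j) (A x) := fun j x ↦ by
    rw [← mul_apply_eq_comp, ← pow_succ', pow_succ, mul_apply_eq_comp]
  have hadd : y (m + 1 + k) = (A ^ (m + 1)) ((A ^ k) w) := by
    rw [← hw, pow_add, mul_apply_eq_comp]
  have hSym : S (A (y m)) = (A ^ (m + 1)) (S u) := by
    rw [← hu, ← hSA, pow_succ', mul_apply_eq_comp]
  have hSyn : S (A (y (m + 1 + k))) = (A ^ (m + 1)) (S (A ((A ^ k) w))) := by
    rw [hadd, hAA, hSA]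
  have key := hyw m (S (A (y m)) + (y (m + 1 + k) - S (A (y (m + 1 + k)))))
    ⟨S u + ((A ^ k) w - S (A ((A ^ k) w))), by rw [hSym, hSyn, map_add, map_sub, hadd]⟩
  have hrw : (T ^ l) (y (m + 1 + k)) - (T ^ l) (y m) =
      -(y m - (S (A (y m)) + (y (m + 1 + k) - S (A (y (m + 1 + k)))))) := by
    rw [hS, hS]; abel
  rw [Nat.succ_eq_add_one, hrw, norm_neg]
  exact key

/-- If `T` is power compact, then `1 - T` becomes invertible after adding a finite rank
operator. -/
theorem exists_finiteRank_isUnit [CompleteSpace X] {T : X →L[ℂ] X} (hT : IsPowerCompact T) :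
    ∃ (N : Submodule ℂ X) (π : X →L[ℂ] N), FiniteDimensional ℂ N ∧
      IsUnit (1 - T + N.subtypeL.comp π) := by
  obtain ⟨m, hm⟩ := exists_ker_pow_eq hT
  have hfin := finiteDimensional_ker_pow hT m
  let N : Submodule ℂ X := ((1 - T) ^ m).ker
  obtain ⟨π, hπ⟩ := Submodule.ClosedComplemented.of_finiteDimensional N
  refine ⟨N, π, hfin, ?_⟩
  set P : X →L[ℂ] X := N.subtypeL.comp π
  have hP : IsCompactOperator P :=
    (isCompactOperator_of_locallyCompactSpace_rng N.subtypeL).comp_clm π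
  have hTP : IsPowerCompact (T - P) := by
    obtain ⟨l, hl, hc⟩ := hT
    refine ⟨l, hl, ?_⟩
    -- Modulo compact operators, `T - P` and `T` have the same powers.
    have : ∀ n, IsCompactOperator ((T - P) ^ n - T ^ n : X →L[ℂ] X) := by
      intro n
      induction n with
      | zero => simpa using isCompactOperator_zero
      | succ n ih =>
        have : (T - P) ^ (n + 1) - T ^ (n + 1) = ((T - P) ^ n - T ^ n) * (T - P) - T ^ n * P := by
          rw [pow_succ, pow_succ]; noncomm_ring
        rw [this]
        exact (ih.comp_clm (T - P)).sub (hP.clm_comp (T ^ n))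
    have h2 := (this l).add hc
    rw [← FunLike.coe_add, sub_add_cancel] at h2
    exact h2
  have heq : 1 - T + P = 1 - (T - P) := by abel
  rw [heq]
  apply isUnit_one_sub_of_injective hTP
  rw [← heq, injective_iff_map_eq_zero]
  intro x hx
  -- If `(1 - T)x = -πx`, then `x ∈ ker (1 - T)^(m+1) = N`, so `πx = x` and `1 - T` acts on `x` as
  -- `-1`; being nilpotent on `N`, it forces `x = 0`.
  have h1 : (1 - T) x = -((π x : N) : X) := eq_neg_of_add_eq_zero_left hx
  have hmem : (1 - T) x ∈ N := h1 ▸ N.neg_mem (π x).2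
  have hxN : ((1 - T) ^ m) x = 0 := hm x (by
    rw [pow_succ, mul_apply_eq_comp]; exact hmem)
  have hπx : ((π x : N) : X) = x := congrArg Subtype.val (hπ ⟨x, hxN⟩)
  rw [hπx] at h1
  have hpow : ∀ k, ((1 - T) ^ k) x = (-1 : ℂ) ^ k • x := by
    intro k
    induction k with
    | zero => simp
    | succ k ih =>
      rw [pow_succ', mul_apply_eq_comp, ih, map_smul, h1, pow_succ]
      simp
  rw [hpow] at hxN
  simpa using hxN

end PowerCompact

/-! ### Analytic families of matrices. -/

section FiniteDimensional

open Filter Topology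

variable {N : Type*} [NormedAddCommGroup N] [NormedSpace ℂ N] [FiniteDimensional ℂ N]

theorem analyticAt_matrix_det {n : ℕ} {m : ℂ → Matrix (Fin n) (Fin n) ℂ} {z₀ : ℂ}
    (hm : ∀ i j, AnalyticAt ℂ (fun z ↦ m z i j) z₀) : AnalyticAt ℂ (fun z ↦ (m z).det) z₀ := by
  simp only [Matrix.det_apply']
  exact Finset.analyticAt_fun_sum _ fun σ _ ↦
    analyticAt_const.mul (Finset.analyticAt_fun_prod _ fun i _ ↦ hm _ _)

/-- An analytic family of endomorphisms of a finite-dimensional space has an analytic adjugate and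
an analytic determinant. -/
theorem exists_analyticAt_adjugate {f : ℂ → N →L[ℂ] N} {z₀ : ℂ} (hf : AnalyticAt ℂ f z₀) :
    ∃ (D : ℂ → ℂ) (J : ℂ → N →L[ℂ] N), AnalyticAt ℂ D z₀ ∧ AnalyticAt ℂ J z₀ ∧
      (∀ z, J z * f z = D z • 1) ∧ (∀ z, f z * J z = D z • 1) ∧
      ∀ z, D z = 0 → ¬ IsUnit (f z) := by
  let e : (N →L[ℂ] N) ≃ₐ[ℂ] Matrix (Fin (Module.finrank ℂ N)) (Fin (Module.finrank ℂ N)) ℂ :=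
    (Module.End.toContinuousLinearMap N).symm.trans
      (LinearMap.toMatrixAlgEquiv (Module.finBasis ℂ N))
  have hentry : ∀ i j, AnalyticAt ℂ (fun z ↦ e (f z) i j) z₀ := fun i j ↦
    ((LinearMap.toContinuousLinearMap
      (Matrix.entryLinearMap ℂ ℂ i j ∘ₗ e.toLinearMap)).analyticAt (f z₀)).fun_comp hf
  refine ⟨fun z ↦ (e (f z)).det, fun z ↦ e.symm (e (f z)).adjugate, analyticAt_matrix_det hentry,
    ?_, fun z ↦ ?_, fun z ↦ ?_, fun z hz hu ↦ ?_⟩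
  · have h : ∀ z, e.symm (e (f z)).adjugate =
        ∑ i, ∑ j, (e (f z)).adjugate i j • e.symm (Matrix.single i j 1) := fun z ↦ by
      conv_lhs => rw [Matrix.matrix_eq_sum_single (e (f z)).adjugate]
      simp only [map_sum, ← map_smul, Matrix.smul_single, smul_eq_mul, mul_one]
    simp only [h]
    refine Finset.analyticAt_fun_sum _ fun i _ ↦ Finset.analyticAt_fun_sum _ fun j _ ↦
      AnalyticAt.fun_smul ?_ analyticAt_const
    simp only [Matrix.adjugate_apply]
    refine analyticAt_matrix_det fun k l ↦ ?_
    simp only [Matrix.updateRow_apply]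
    split_ifs
    · exact analyticAt_const
    · exact hentry k l
  · apply e.injective
    simp [Matrix.adjugate_mul]
  · apply e.injective
    simp [Matrix.mul_adjugate]
  · have := (Matrix.isUnit_iff_isUnit_det _).1 (hu.map e)
    exact this.ne_zero hz

end FiniteDimensional

/-! ### Meromorphy of the resolvent and discreteness of the spectrum. -/

section Resolvent

open Filter Topology

variable {X : Type*} [NormedAddCommGroup X] [NormedSpace ℂ X]

/-- `B` becomes invertible after adding a finite rank operator. -/
def InvertibleModFiniteRank (B : X →L[ℂ] X) : Prop :=
  ∃ (N : Submodule ℂ X) (π : X →L[ℂ] N), FiniteDimensional ℂ N ∧ IsUnit (B + N.subtypeL.comp π)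

theorem analyticAt_resolvent [CompleteSpace X] {A : X →L[ℂ] X} {z₀ : ℂ} (h : z₀ ∈ resolventSet ℂ A) :
    AnalyticAt ℂ (resolvent A) z₀ := by
  refine DifferentiableOn.analyticAt (s := resolventSet ℂ A) (fun z hz ↦ ?_)
    ((spectrum.isOpen_resolventSet A).mem_nhds h)
  exact (spectrum.hasDerivAt_resolvent_const_left hz).differentiableAt.differentiableWithinAt

theorem apply_resolvent {A : X →L[ℂ] X} {z : ℂ} (h : z ∈ resolventSet ℂ A) (x : X) :
    z • resolvent A z x - A (resolvent A z x) = x := by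
  have := congrArg (fun S : X →L[ℂ] X ↦ S x) (Ring.mul_inverse_cancel _ h)
  simpa [resolvent, Algebra.algebraMap_eq_smul_one] using this

theorem resolvent_apply {A : X →L[ℂ] X} {z : ℂ} (h : z ∈ resolventSet ℂ A) (x : X) :
    resolvent A z (z • x - A x) = x := by
  have := congrArg (fun S : X →L[ℂ] X ↦ S x) (Ring.inverse_mul_cancel _ h)
  simpa [resolvent, Algebra.algebraMap_eq_smul_one] using this

theorem analyticAt_comp_comp {E F Y Z : Type*} [NormedAddCommGroup E] [NormedSpace ℂ E]
    [NormedAddCommGroup F] [NormedSpace ℂ F] [NormedAddCommGroup Y] [NormedSpace ℂ Y]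
    [NormedAddCommGroup Z] [NormedSpace ℂ Z] (a : Y →L[ℂ] Z) (b : E →L[ℂ] F)
    {f : ℂ → F →L[ℂ] Y} {z₀ : ℂ} (hf : AnalyticAt ℂ f z₀) :
    AnalyticAt ℂ (fun z ↦ a ∘L f z ∘L b) z₀ :=
  (((ContinuousLinearMap.compL ℂ E Y Z a) ∘L
    ((ContinuousLinearMap.compL ℂ E F Y).flip b)).analyticAt (f z₀)).fun_comp hf

/-- Woodbury's formula: `G` inverts `z - A + ιπ`, and removing the finite rank term costs only the
inverse `d⁻¹ j` of `1 - πGι` on `N`. -/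
theorem resolvent_eq_of_adjugate {N : Type*} [NormedAddCommGroup N] [NormedSpace ℂ N]
    {A G : X →L[ℂ] X} {ι : N →L[ℂ] X} {π : X →L[ℂ] N} {j : N →L[ℂ] N} {z d : ℂ}
    (hGl : ∀ x, G (z • x - A x + ι (π x)) = x) (hGr : ∀ x, z • G x - A (G x) + ι (π (G x)) = x)
    (hjl : ∀ v, j v - j (π (G (ι v))) = d • v) (hjr : ∀ v, j v - π (G (ι (j v))) = d • v)
    (hd : d ≠ 0) :
    z ∈ resolventSet ℂ A ∧ resolvent A z = d⁻¹ • (d • G + G * (ι ∘L j ∘L π) * G) := by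
  set R : X →L[ℂ] X := d⁻¹ • (d • G + G * (ι ∘L j ∘L π) * G) with hR
  have hRapp : ∀ x, R x = G x + d⁻¹ • G (ι (j (π (G x)))) := fun x ↦ by
    simp only [hR, smul_apply, add_apply, mul_apply_eq_comp, ContinuousLinearMap.comp_apply,
      smul_add, smul_smul, inv_mul_cancel₀ hd, one_smul]
  have hGr' : ∀ x, z • G x - A (G x) = x - ι (π (G x)) := fun x ↦ eq_sub_of_add_eq (hGr x)
  have hr : (algebraMap ℂ (X →L[ℂ] X) z - A) * R = 1 := by
    ext x
    simp only [Algebra.algebraMap_eq_smul_one, sub_apply, smul_apply, mul_apply_eq_comp,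
      one_apply_eq_self]
    have h1 : z • R x - A (R x) = (z • G x - A (G x)) +
        d⁻¹ • (z • G (ι (j (π (G x)))) - A (G (ι (j (π (G x)))))) := by
      rw [hRapp, map_add, map_smul, smul_add, smul_comm z, smul_sub]; abel
    rw [h1, hGr', hGr', ← map_sub, hjr, map_smul, smul_smul, inv_mul_cancel₀ hd, one_smul,
      sub_add_cancel]
  have hl : R * (algebraMap ℂ (X →L[ℂ] X) z - A) = 1 := by
    ext x
    simp only [Algebra.algebraMap_eq_smul_one, sub_apply, smul_apply, mul_apply_eq_comp,
      one_apply_eq_self]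
    have h1 : G (z • x - A x) = x - G (ι (π x)) := by
      have := hGl x
      rw [map_add] at this
      exact eq_sub_of_add_eq this
    rw [hRapp, h1, map_sub, map_sub, hjl, map_smul, map_smul, smul_smul, inv_mul_cancel₀ hd,
      one_smul, sub_add_cancel]
  exact ⟨spectrum.mem_resolventSet_iff.2 ⟨⟨_, R, hr, hl⟩, rfl⟩,
    Ring.inverse_unit (⟨_, R, hr, hl⟩ : (X →L[ℂ] X)ˣ)⟩

/-- A kernel vector `v` of `1 - πGι` yields the eigenvector `Gιv` of `A`, nonzero because `π` sends
it back to `v`. -/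
theorem mem_spectrum_of_not_isUnit {N : Type*} [NormedAddCommGroup N] [NormedSpace ℂ N]
    [FiniteDimensional ℂ N] {A G : X →L[ℂ] X} {ι : N →L[ℂ] X} {π : X →L[ℂ] N} {z : ℂ}
    (hGr : ∀ x, z • G x - A (G x) + ι (π (G x)) = x) (hu : ¬ IsUnit (1 - π ∘L G ∘L ι)) :
    z ∈ spectrum ℂ A := by
  have hni : ¬ Function.Injective (1 - π ∘L G ∘L ι : N →L[ℂ] N) := fun hinj ↦ by
    have := FiniteDimensional.complete ℂ N
    apply hu
    rw [ContinuousLinearMap.isUnit_iff_bijective]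
    exact ⟨hinj, (LinearMap.injective_iff_surjective
      (f := ((1 - π ∘L G ∘L ι : N →L[ℂ] N) : N →ₗ[ℂ] N))).1 hinj⟩
  rw [injective_iff_map_eq_zero] at hni
  push Not at hni
  obtain ⟨v, hv, hv0⟩ := hni
  have hv' : π (G (ι v)) = v := (sub_eq_zero.1 hv).symm
  rintro ⟨a, ha⟩
  have hx : G (ι v) = 0 := by
    have h1 : (a : X →L[ℂ] X) (G (ι v)) = 0 := by
      have h2 := hGr (ι v)
      rw [hv', add_eq_right] at h2
      rw [ha]
      simpa [Algebra.algebraMap_eq_smul_one] using h2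
    have h3 : (↑a⁻¹ : X →L[ℂ] X) ((a : X →L[ℂ] X) (G (ι v))) = G (ι v) :=
      congrArg (fun S : X →L[ℂ] X ↦ S (G (ι v))) a.inv_mul
    rw [← h3, h1, map_zero]
  rw [hx, map_zero] at hv'
  exact hv0 hv'.symm

variable [CompleteSpace X]

/-- Near a point at which `z - A` is invertible modulo finite rank, the resolvent of `A` is a
quotient of analytic functions, and the spectrum is the zero set of the denominator. -/
theorem exists_resolvent_eq_quotient {A : X →L[ℂ] X} {z₀ : ℂ}
    (h : InvertibleModFiniteRank (algebraMap ℂ (X →L[ℂ] X) z₀ - A)) :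
    ∃ (D : ℂ → ℂ) (H : ℂ → X →L[ℂ] X), AnalyticAt ℂ D z₀ ∧ AnalyticAt ℂ H z₀ ∧
      ∀ᶠ z in 𝓝 z₀, (D z = 0 → z ∈ spectrum ℂ A) ∧
        (D z ≠ 0 → z ∈ resolventSet ℂ A ∧ resolvent A z = (D z)⁻¹ • H z) := by
  obtain ⟨N, π, hN, hu⟩ := h
  let ι : N →L[ℂ] X := N.subtypeL
  let A' : X →L[ℂ] X := A - ι ∘L π
  have hz₀ : z₀ ∈ resolventSet ℂ A' := by
    rw [spectrum.mem_resolventSet_iff, sub_sub_eq_add_sub, add_sub_right_comm]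
    exact hu
  let G : ℂ → X →L[ℂ] X := resolvent A'
  have hG : AnalyticAt ℂ G z₀ := analyticAt_resolvent hz₀
  have hM : AnalyticAt ℂ (fun z ↦ 1 - π ∘L G z ∘L ι) z₀ :=
    analyticAt_const.fun_sub
      (analyticAt_comp_comp π ι hG)
  obtain ⟨D, J, hD, hJ, hJf, hfJ, hD0⟩ := exists_analyticAt_adjugate hM
  refine ⟨D, fun z ↦ D z • G z + G z * (ι ∘L J z ∘L π) * G z, hD,
    (hD.fun_smul hG).fun_add ((hG.mul
      (analyticAt_comp_comp ι π hJ)).mul hG), ?_⟩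
  filter_upwards [(spectrum.isOpen_resolventSet A').mem_nhds hz₀] with z hz
  have hGl : ∀ x, G z (z • x - A x + ι (π x)) = x := fun x ↦ by
    rw [sub_add]
    exact resolvent_apply hz x
  have hGr : ∀ x, z • G z x - A (G z x) + ι (π (G z x)) = x := fun x ↦ by
    rw [sub_add]
    exact apply_resolvent hz x
  exact ⟨fun hDz ↦ mem_spectrum_of_not_isUnit hGr (hD0 z hDz), fun hDz ↦
    resolvent_eq_of_adjugate hGl hGr
      (fun v ↦ by
        rw [← map_sub]
        exact congrArg (fun S : N →L[ℂ] N ↦ S v) (hJf z))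
      (fun v ↦ congrArg (fun S : N →L[ℂ] N ↦ S v) (hfJ z)) hDz⟩

/-- An analytic denominator vanishes identically near `z₀` or has no other zero nearby. -/
theorem eventually_mem_spectrum_or_resolventSet {A : X →L[ℂ] X} {z₀ : ℂ}
    (h : InvertibleModFiniteRank (algebraMap ℂ (X →L[ℂ] X) z₀ - A)) :
    (∀ᶠ z in 𝓝 z₀, z ∈ spectrum ℂ A) ∨ ∀ᶠ z in 𝓝[≠] z₀, z ∈ resolventSet ℂ A := by
  obtain ⟨D, H, hD, -, hz⟩ := exists_resolvent_eq_quotient h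
  rcases hD.eventually_eq_zero_or_eventually_ne_zero with h0 | h0
  · exact Or.inl (by filter_upwards [h0, hz] with z h1 h2 using h2.1 h1)
  · exact Or.inr (by
      filter_upwards [h0, hz.filter_mono nhdsWithin_le_nhds] with z h1 h2 using (h2.2 h1).1)

/-- An isolated point of the spectrum at which `z - A` is invertible modulo finite rank is a pole
of the resolvent. -/
theorem exists_leading_coeff {A : X →L[ℂ] X} {z₀ : ℂ}
    (h : InvertibleModFiniteRank (algebraMap ℂ (X →L[ℂ] X) z₀ - A)) (hz₀ : z₀ ∈ spectrum ℂ A)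
    (hiso : ∀ᶠ z in 𝓝[≠] z₀, z ∈ resolventSet ℂ A) :
    ∃ (k : ℕ) (Q : X →L[ℂ] X), Q ≠ 0 ∧
      Tendsto (fun z ↦ (z - z₀) ^ k • resolvent A z) (𝓝[≠] z₀) (𝓝 Q) ∧
      (∀ x, A (Q x) = z₀ • Q x) ∧ ∀ x, Q (A x) = z₀ • Q x := by
  have hmero : MeromorphicAt (resolvent A) z₀ := by
    obtain ⟨D, H, hD, hH, hz⟩ := exists_resolvent_eq_quotient h
    refine (hD.meromorphicAt.inv.smul hH.meromorphicAt).congr ?_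
    filter_upwards [hiso, hz.filter_mono nhdsWithin_le_nhds] with z h1 h2
    have : D z ≠ 0 := fun h0 ↦ h2.1 h0 h1
    simp [(h2.2 this).2]
  have hres : ∀ᶠ z in 𝓝[≠] z₀, (algebraMap ℂ (X →L[ℂ] X) z - A) * resolvent A z = 1 ∧
      resolvent A z * (algebraMap ℂ (X →L[ℂ] X) z - A) = 1 := by
    filter_upwards [hiso] with z hz using
      ⟨Ring.mul_inverse_cancel _ hz, Ring.inverse_mul_cancel _ hz⟩
  have halg : Tendsto (fun z ↦ algebraMap ℂ (X →L[ℂ] X) z - A) (𝓝[≠] z₀)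
      (𝓝 (algebraMap ℂ (X →L[ℂ] X) z₀ - A)) :=
    (((algebraMapCLM ℂ (X →L[ℂ] X)).continuous.sub continuous_const).tendsto z₀).mono_left
      nhdsWithin_le_nhds
  have hnontriv : Nontrivial (X →L[ℂ] X) := by
    by_contra hn
    rw [not_nontrivial_iff_subsingleton] at hn
    exact hz₀ (isUnit_of_subsingleton _)
  have hne : meromorphicOrderAt (resolvent A) z₀ ≠ ⊤ := by
    intro htop
    rw [meromorphicOrderAt_eq_top_iff] at htop
    obtain ⟨z, h1, h2, -⟩ := (htop.and hres).exists
    rw [h1, mul_zero] at h2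
    exact zero_ne_one h2
  obtain ⟨n, hn⟩ := WithTop.ne_top_iff_exists.1 hne
  obtain ⟨g, hg, hg0, hgR⟩ := (meromorphicOrderAt_eq_int_iff hmero).1 hn.symm
  have hgt : Tendsto g (𝓝[≠] z₀) (𝓝 (g z₀)) :=
    hg.continuousAt.tendsto.mono_left nhdsWithin_le_nhds
  -- With nonnegative order the resolvent would have a limit at `z₀`, and that limit would invert
  -- `z₀ - A`.
  have hneg : n < 0 := by
    by_contra hn0
    obtain ⟨m, rfl⟩ := Int.eq_ofNat_of_zero_le (not_lt.1 hn0)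
    have hlim : Tendsto (resolvent A) (𝓝[≠] z₀) (𝓝 ((z₀ - z₀) ^ m • g z₀)) := by
      have : Tendsto (fun z : ℂ ↦ (z - z₀) ^ m) (𝓝[≠] z₀) (𝓝 ((z₀ - z₀) ^ m)) :=
        (Continuous.tendsto (by fun_prop) z₀).mono_left nhdsWithin_le_nhds
      refine (this.smul hgt).congr' ?_
      filter_upwards [hgR] with z hz
      rw [hz, zpow_natCast]
    have h1 := tendsto_nhds_unique (halg.mul hlim)
      (tendsto_const_nhds.congr' (hres.mono fun z hz ↦ hz.1.symm))
    have h2 := tendsto_nhds_unique (hlim.mul halg)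
      (tendsto_const_nhds.congr' (hres.mono fun z hz ↦ hz.2.symm))
    exact hz₀ ⟨⟨_, _, h1, h2⟩, rfl⟩
  obtain ⟨k, rfl⟩ := Int.eq_negSucc_of_lt_zero hneg
  have hlim : Tendsto (fun z ↦ (z - z₀) ^ (k + 1) • resolvent A z) (𝓝[≠] z₀) (𝓝 (g z₀)) := by
    refine hgt.congr' ?_
    filter_upwards [hgR, self_mem_nhdsWithin] with z hz hzne
    have : (z - z₀) ^ (k + 1) ≠ 0 := pow_ne_zero _ (sub_ne_zero.2 hzne)
    rw [hz, zpow_negSucc, smul_smul, mul_inv_cancel₀ this, one_smul]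
  have hzero : Tendsto (fun z : ℂ ↦ (z - z₀) ^ (k + 1) • (1 : X →L[ℂ] X)) (𝓝[≠] z₀) (𝓝 0) := by
    have : Tendsto (fun z : ℂ ↦ (z - z₀) ^ (k + 1) • (1 : X →L[ℂ] X)) (𝓝 z₀)
        (𝓝 ((z₀ - z₀) ^ (k + 1) • (1 : X →L[ℂ] X))) := Continuous.tendsto (by fun_prop) z₀
    rw [sub_self, zero_pow k.succ_ne_zero, zero_smul] at this
    exact this.mono_left nhdsWithin_le_nhds
  -- Limit of `(z - A)(z - z₀)^(k+1)(z - A)⁻¹ = (z - z₀)^(k+1)`, where the exponent is positive.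
  have h1 : (algebraMap ℂ (X →L[ℂ] X) z₀ - A) * g z₀ = 0 :=
    tendsto_nhds_unique ((halg.mul hlim).congr' (by
      filter_upwards [hres] with z hz
      rw [mul_smul_comm, hz.1])) hzero
  have h2 : g z₀ * (algebraMap ℂ (X →L[ℂ] X) z₀ - A) = 0 :=
    tendsto_nhds_unique ((hlim.mul halg).congr' (by
      filter_upwards [hres] with z hz
      rw [smul_mul_assoc, hz.2])) hzero
  refine ⟨k + 1, g z₀, hg0, hlim, fun x ↦ ?_, fun x ↦ ?_⟩
  · have := congrArg (fun S : X →L[ℂ] X ↦ S x) h1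
    simp only [Algebra.algebraMap_eq_smul_one, sub_apply, smul_apply, mul_apply_eq_comp,
      one_apply_eq_self, zero_apply] at this
    exact (sub_eq_zero.1 this).symm
  · have := congrArg (fun S : X →L[ℂ] X ↦ S x) h2
    simp only [Algebra.algebraMap_eq_smul_one, sub_apply, smul_apply, mul_apply_eq_comp,
      one_apply_eq_self, zero_apply, map_sub, map_smul] at this
    exact (sub_eq_zero.1 this).symm

/-- If `z - A` is invertible modulo finite rank for `w < ‖z‖`, the spectrum of `A` is discrete
in this region. -/
theorem eventually_mem_resolventSet {A : X →L[ℂ] X} {w : ℝ} (hw : 0 ≤ w)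
    (h : ∀ z : ℂ, w < ‖z‖ → InvertibleModFiniteRank (algebraMap ℂ (X →L[ℂ] X) z - A))
    {z₀ : ℂ} (hz₀ : w < ‖z₀‖) : ∀ᶠ z in 𝓝[≠] z₀, z ∈ resolventSet ℂ A := by
  refine (eventually_mem_spectrum_or_resolventSet (h z₀ hz₀)).resolve_left fun hev ↦ ?_
  have hpos : 0 < ‖z₀‖ := hw.trans_lt hz₀
  -- Both alternatives are open conditions. Along this ray, which stays in `‖z‖ > w`, the first
  -- holds at `t = 1` and the second for large `t`, so by connectedness they meet: a contradiction.
  let ray : ℝ → ℂ := fun t ↦ (t : ℂ) * z₀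
  have hray : Continuous ray := by fun_prop
  have hnorm : ∀ t : ℝ, 1 ≤ t → ‖ray t‖ = t * ‖z₀‖ := fun t ht ↦ by
    rw [norm_mul, Complex.norm_real, Real.norm_of_nonneg (zero_le_one.trans ht)]
  let u : Set ℂ := {x | ∀ᶠ z in 𝓝 x, z ∈ spectrum ℂ A}
  let v : Set ℂ := {x | ∀ᶠ z in 𝓝[≠] x, z ∈ resolventSet ℂ A}
  have hu : IsOpen u := isOpen_setOfPred_eventually_nhds
  have hv : IsOpen v := isOpen_setOfPred_eventually_nhdsWithin
  obtain ⟨t, ht, htu, htv⟩ := isPreconnected_Ici (a := (1 : ℝ)) (ray ⁻¹' u) (ray ⁻¹' v)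
    (hu.preimage hray) (hv.preimage hray)
    (fun t ht ↦ eventually_mem_spectrum_or_resolventSet (h (ray t) (by
      rw [hnorm t ht]
      exact hz₀.trans_le (le_mul_of_one_le_left hpos.le ht))))
    ⟨1, Set.self_mem_Ici, by
      change ∀ᶠ z in 𝓝 (((1 : ℝ) : ℂ) * z₀), z ∈ spectrum ℂ A
      rwa [Complex.ofReal_one, one_mul]⟩
    (by
      let t : ℝ := max 1 ((‖A‖ * ‖(1 : X →L[ℂ] X)‖ + 1) / ‖z₀‖)
      refine ⟨t, Set.mem_Ici.2 (le_max_left _ _), ?_⟩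
      have hmem : ray t ∈ resolventSet ℂ A := by
        apply spectrum.mem_resolventSet_of_norm_lt_mul
        rw [hnorm t (le_max_left _ _)]
        have : (‖A‖ * ‖(1 : X →L[ℂ] X)‖ + 1) / ‖z₀‖ ≤ t := le_max_right _ _
        rw [div_le_iff₀ hpos] at this
        linarith
      exact mem_nhdsWithin_of_mem_nhds ((spectrum.isOpen_resolventSet A).mem_nhds hmem))
  have htu' : ∀ᶠ z in 𝓝 (ray t), z ∈ spectrum ℂ A := htu
  have htv' : ∀ᶠ z in 𝓝[≠] (ray t), z ∈ resolventSet ℂ A := htv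
  obtain ⟨z, h1, h2⟩ := ((htu'.filter_mono nhdsWithin_le_nhds).and htv').exists
  exact h1 h2

/-- An infinite closed subset of the compact spectrum would accumulate at one of its own points,
where `‖z‖ ≥ κ > w` and discreteness holds. -/
theorem finite_spectrum_inter {A : X →L[ℂ] X} {w κ : ℝ} (hw : 0 ≤ w) (hκ : w < κ)
    (h : ∀ z : ℂ, w < ‖z‖ → InvertibleModFiniteRank (algebraMap ℂ (X →L[ℂ] X) z - A)) :
    (spectrum ℂ A ∩ {z : ℂ | κ ≤ ‖z‖}).Finite := by
  by_contra hinf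
  have hcpt : IsCompact (spectrum ℂ A ∩ {z : ℂ | κ ≤ ‖z‖}) :=
    (spectrum.isCompact A).inter_right (isClosed_le continuous_const continuous_norm)
  obtain ⟨z, hz, hacc⟩ := Set.Infinite.exists_accPt_of_subset_isCompact hinf hcpt Set.Subset.rfl
  rw [accPt_iff_frequently_nhdsNE] at hacc
  obtain ⟨y, hy, hy'⟩ := (hacc.and_eventually
    (eventually_mem_resolventSet hw h (hκ.trans_le hz.2))).exists
  exact hy.1 hy'

end Resolvent

/-! ### Neumann series and growth of the resolvent. -/

section Neumann

open Filter Topology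

variable {A : Type*} [NormedRing A] [NormedAlgebra ℂ A] [CompleteSpace A]

/-- The Neumann series of the resolvent converges outside the spectral radius. -/
theorem hasSum_resolvent {a : A} {z : ℂ} (h : spectralRadius ℂ a < ‖z‖₊) :
    HasSum (fun n : ℕ ↦ z⁻¹ ^ (n + 1) • a ^ n) (resolvent a z) := by
  have hz : z ≠ 0 := by rintro rfl; simp at h
  have h' : (‖z⁻¹‖₊ : ℝ≥0∞) < (spectralRadius ℂ a)⁻¹ := by
    rw [nnnorm_inv, ENNReal.coe_inv (nnnorm_ne_zero_iff.2 hz)]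
    exact ENNReal.inv_lt_inv.2 h
  obtain ⟨s, hs, hs'⟩ := ENNReal.lt_iff_exists_nnreal_btwn.1 h'
  have hspos : 0 < s := lt_of_le_of_lt zero_le (ENNReal.coe_lt_coe.1 hs)
  -- `(1 - wa)⁻¹` is analytic for `|w|` below the inverse spectral radius, so by uniqueness its
  -- Taylor series, the geometric series, converges there; then `w = z⁻¹`.
  have H := (spectrum.hasFPowerSeriesOnBall_inverse_one_sub_smul ℂ a).exchange_radius
    ((spectrum.differentiableOn_inverse_one_sub_smul hs').hasFPowerSeriesOnBall hspos)
  have hsum := (H.hasSum (y := z⁻¹) (by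
    rw [Metric.mem_eball, edist_zero_right, enorm_eq_nnnorm]
    exact hs)).const_smul z⁻¹
  have hval : z⁻¹ • Ring.inverse (1 - z⁻¹ • a) = resolvent a z := by
    have hmem : z ∈ resolventSet ℂ a := spectrum.mem_resolventSet_of_spectralRadius_lt h
    have heq : algebraMap ℂ A z - a = z • (1 - z⁻¹ • a) := by
      rw [smul_sub, smul_smul, mul_inv_cancel₀ hz, one_smul, Algebra.algebraMap_eq_smul_one]
    have hr := Ring.mul_inverse_cancel _ hmem
    have hl := Ring.inverse_mul_cancel _ hmem
    have hu : Ring.inverse (1 - z⁻¹ • a) = z • resolvent a z :=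
      Ring.inverse_unit (⟨1 - z⁻¹ • a, z • resolvent a z, by
        rw [mul_smul_comm, ← smul_mul_assoc, ← heq]; exact hr, by
        rw [smul_mul_assoc, ← mul_smul_comm, ← heq]; exact hl⟩ : Aˣ)
    rw [hu, smul_smul, inv_mul_cancel₀ hz, one_smul]
  rw [zero_add, hval] at hsum
  have hterm : (fun n : ℕ ↦ z⁻¹ ^ (n + 1) • a ^ n) = fun n ↦
      z⁻¹ • (ContinuousMultilinearMap.mkPiRing ℂ (Fin n) (a ^ n)) fun _ ↦ z⁻¹ := by
    funext n
    simp [pow_succ', smul_smul]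
  rw [hterm]
  exact hsum

/-- The resolvent is large near the spectrum. -/
theorem one_le_norm_resolvent_mul {a : A} {z z₀ : ℂ} (hz : z ∈ resolventSet ℂ a)
    (hz₀ : z₀ ∈ spectrum ℂ a) : 1 ≤ ‖resolvent a z‖ * (‖z₀ - z‖ * ‖(1 : A)‖) := by
  by_contra! hlt
  have hnontriv : Nontrivial A := by
    by_contra hn
    rw [not_nontrivial_iff_subsingleton] at hn
    exact hz₀ (isUnit_of_subsingleton _)
  obtain ⟨u, hu⟩ := id hz
  have hres : resolvent a z = ↑u⁻¹ := by
    change Ring.inverse _ = _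
    rw [← hu, Ring.inverse_unit]
  rw [hres] at hlt
  apply hz₀
  refine (Units.ofNearby u (algebraMap ℂ A z₀ - a) ?_).isUnit
  rw [hu, sub_sub_sub_cancel_right, ← map_sub, norm_algebraMap,
    ← one_div, lt_div_iff₀ (Units.norm_pos u⁻¹), mul_comm]
  exact hlt

end Neumann

/-! ### Complexification and the factorization of `z - U`. -/

section Complexify

variable {E : Type*} [MeasurableSpace E] {p : ℝ≥0∞} {μ : Measure E} [Fact (1 ≤ p)]

theorem re_incl (g : Lp ℝ p μ) : re (incl g) = g := by
  apply Lp.ext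
  filter_upwards [coeFn_re (incl g), coeFn_incl g] with x h1 h2
  rw [h1, h2, Complex.ofReal_re]

theorem im_incl (g : Lp ℝ p μ) : im (incl g) = 0 := by
  apply Lp.ext
  filter_upwards [coeFn_im (incl g), coeFn_incl g, Lp.coeFn_zero ℝ p μ] with x h1 h2 h3
  rw [h1, h2, Complex.ofReal_im, h3, Pi.zero_apply]

theorem ext_re_im {f g : Lp ℂ p μ} (hre : re f = re g) (him : im f = im g) : f = g := by
  apply Lp.ext
  filter_upwards [coeFn_re f, coeFn_re g, coeFn_im f, coeFn_im g] with x h1 h2 h3 h4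
  apply Complex.ext
  · rw [← h1, ← h2, hre]
  · rw [← h3, ← h4, him]

theorem re_I_smul (f : Lp ℂ p μ) : re (Complex.I • f) = -im f := by simp [re_smul]

theorem im_I_smul (f : Lp ℂ p μ) : im (Complex.I • f) = re f := by simp [im_smul]

theorem incl_re_add_im (f : Lp ℂ p μ) : incl (re f) + Complex.I • incl (im f) = f := by
  apply ext_re_im
  · rw [map_add, re_incl, re_I_smul, im_incl, neg_zero, add_zero]
  · rw [map_add, im_incl, im_I_smul, re_incl, zero_add]

theorem complexify_apply (U : Lp ℝ p μ →L[ℝ] Lp ℝ p μ) (f : Lp ℂ p μ) :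
    complexify U f = incl (U (re f)) + Complex.I • incl (U (im f)) := rfl

theorem re_complexify (U : Lp ℝ p μ →L[ℝ] Lp ℝ p μ) (f : Lp ℂ p μ) :
    re (complexify U f) = U (re f) := by
  rw [complexify_apply, map_add, re_incl, re_I_smul, im_incl, neg_zero, add_zero]

theorem im_complexify (U : Lp ℝ p μ →L[ℝ] Lp ℝ p μ) (f : Lp ℂ p μ) :
    im (complexify U f) = U (im f) := by
  rw [complexify_apply, map_add, im_incl, im_I_smul, re_incl, zero_add]

theorem complexify_incl (U : Lp ℝ p μ →L[ℝ] Lp ℝ p μ) (g : Lp ℝ p μ) :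
    complexify U (incl g) = incl (U g) := by
  rw [complexify_apply, re_incl, im_incl, map_zero, map_zero, smul_zero, add_zero]

theorem complexify_add (U V : Lp ℝ p μ →L[ℝ] Lp ℝ p μ) :
    complexify (U + V) = complexify U + complexify V := by
  ext1 f
  apply ext_re_im
  · rw [add_apply, map_add, re_complexify, re_complexify, re_complexify, add_apply]
  · rw [add_apply, map_add, im_complexify, im_complexify, im_complexify, add_apply]

theorem complexify_pow (U : Lp ℝ p μ →L[ℝ] Lp ℝ p μ) (n : ℕ) :
    complexify U ^ n = complexify (U ^ n) := by
  induction n with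
  | zero =>
    ext1 f
    apply ext_re_im
    · rw [re_complexify, pow_zero, pow_zero, one_apply_eq_self, one_apply_eq_self]
    · rw [im_complexify, pow_zero, pow_zero, one_apply_eq_self, one_apply_eq_self]
  | succ n ih =>
    ext1 f
    rw [pow_succ, mul_apply_eq_comp, ih]
    apply ext_re_im
    · rw [re_complexify, re_complexify, re_complexify, pow_succ, mul_apply_eq_comp]
    · rw [im_complexify, im_complexify, im_complexify, pow_succ, mul_apply_eq_comp]

theorem norm_re_le (f : Lp ℂ p μ) : ‖re f‖ ≤ ‖f‖ := by
  have h := Complex.reCLM.norm_compLp_le f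
  rw [Complex.reCLM_norm, one_mul] at h
  exact h

theorem norm_im_le (f : Lp ℂ p μ) : ‖im f‖ ≤ ‖f‖ := by
  have h := Complex.imCLM.norm_compLp_le f
  rw [Complex.imCLM_norm, one_mul] at h
  exact h

theorem norm_incl_le (g : Lp ℝ p μ) : ‖incl g‖ ≤ ‖g‖ := by
  have h := Complex.ofRealCLM.norm_compLp_le g
  rw [Complex.ofRealCLM_norm, one_mul] at h
  exact h

theorem norm_le_re_add_im (f : Lp ℂ p μ) : ‖f‖ ≤ ‖re f‖ + ‖im f‖ := by
  conv_lhs => rw [← incl_re_add_im f]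
  refine (norm_add_le _ _).trans (add_le_add (norm_incl_le _) ?_)
  rw [norm_smul, Complex.norm_I, one_mul]
  exact norm_incl_le _

theorem norm_complexify_le (U : Lp ℝ p μ →L[ℝ] Lp ℝ p μ) : ‖complexify U‖ ≤ 2 * ‖U‖ := by
  refine ContinuousLinearMap.opNorm_le_bound _ (by positivity) fun f ↦ ?_
  refine (norm_le_re_add_im _).trans ?_
  rw [re_complexify, im_complexify]
  have h1 := (U.le_opNorm (re f)).trans (mul_le_mul_of_nonneg_left (norm_re_le f) (norm_nonneg U))
  have h2 := (U.le_opNorm (im f)).trans (mul_le_mul_of_nonneg_left (norm_im_le f) (norm_nonneg U))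
  linarith

/-- The available bound `‖complexify W‖ ≤ 2‖W‖` loses a factor 2; applying it to `W^n` and letting
`n → ∞` removes that factor. -/
theorem mem_resolventSet_complexify {W : Lp ℝ p μ →L[ℝ] Lp ℝ p μ} {z : ℂ} (hz : ‖W‖ < ‖z‖) :
    z ∈ resolventSet ℂ (complexify W) := by
  by_contra hmem
  have hmem' : z ∈ spectrum ℂ (complexify W) := hmem
  have hbound : ∀ n : ℕ, 1 ≤ n → ‖z‖ ^ n ≤
      2 * ‖(1 : Lp ℂ p μ →L[ℂ] Lp ℂ p μ)‖ * ‖W‖ ^ n := fun n hn ↦ by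
    have h1 := spectrum.norm_le_norm_mul_of_mem (spectrum.pow_mem_pow (complexify W) n hmem')
    rw [norm_pow, complexify_pow] at h1
    have h2 : ‖complexify (W ^ n)‖ ≤ 2 * ‖W‖ ^ n :=
      (norm_complexify_le _).trans (by
        have := norm_pow_le' W hn
        linarith)
    nlinarith [norm_nonneg (1 : Lp ℂ p μ →L[ℂ] Lp ℂ p μ)]
  set C := 2 * ‖(1 : Lp ℂ p μ →L[ℂ] Lp ℂ p μ)‖
  have hzpos : 0 < ‖z‖ := (norm_nonneg W).trans_lt hz
  have hlim : Filter.Tendsto (fun n : ℕ ↦ C * (‖W‖ / ‖z‖) ^ n) Filter.atTop (nhds (C * 0)) :=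
    (tendsto_pow_atTop_nhds_zero_of_lt_one (by positivity) ((div_lt_one hzpos).2 hz)).const_mul C
  rw [mul_zero] at hlim
  obtain ⟨n, hn, hn1⟩ := ((hlim.eventually_lt_const one_pos).and
    (Filter.eventually_ge_atTop 1)).exists
  have := hbound n hn1
  rw [div_pow, ← mul_div_assoc, div_lt_one (by positivity)] at hn
  exact this.not_gt hn

/-- `z - U = (1 - K (z - W)⁻¹) (z - W)` for `U = W + K`. -/
theorem algebraMap_sub_complexify {U W K : Lp ℝ p μ →L[ℝ] Lp ℝ p μ} (hsplit : U = W + K) {z : ℂ}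
    (hz : ‖W‖ < ‖z‖) :
    algebraMap ℂ (Lp ℂ p μ →L[ℂ] Lp ℂ p μ) z - complexify U =
      (1 - complexify K * resolvent (complexify W) z) *
        (algebraMap ℂ (Lp ℂ p μ →L[ℂ] Lp ℂ p μ) z - complexify W) := by
  rw [sub_mul, one_mul, mul_assoc, resolvent,
    Ring.inverse_mul_cancel _ (mem_resolventSet_complexify hz), mul_one, hsplit, complexify_add]
  abel

theorem invertibleModFiniteRank {U W K : Lp ℝ p μ →L[ℝ] Lp ℝ p μ} (hsplit : U = W + K) {z : ℂ}
    (hz : ‖W‖ < ‖z‖) (hK : IsPowerCompact (complexify K * resolvent (complexify W) z)) :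
    InvertibleModFiniteRank (algebraMap ℂ (Lp ℂ p μ →L[ℂ] Lp ℂ p μ) z - complexify U) := by
  obtain ⟨N, π, hN, hu⟩ := exists_finiteRank_isUnit hK
  refine ⟨N, π.comp (algebraMap ℂ (Lp ℂ p μ →L[ℂ] Lp ℂ p μ) z - complexify W), hN, ?_⟩
  have := hu.mul (mem_resolventSet_complexify hz)
  rwa [add_mul, ← algebraMap_sub_complexify hsplit hz] at this

/-- As `z - W` is bijective, injectivity of `z - U` passes to `1 - K(z - W)⁻¹`, and the Fredholm
alternative makes both invertible. -/
theorem mem_pointSpectrum {U W K : Lp ℝ p μ →L[ℝ] Lp ℝ p μ} (hsplit : U = W + K) {z : ℂ}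
    (hz : ‖W‖ < ‖z‖) (hK : IsPowerCompact (complexify K * resolvent (complexify W) z))
    (hmem : z ∈ spectrum ℂ (complexify U)) : z ∈ pointSpectrum (complexify U) := by
  intro hinj
  have hres := mem_resolventSet_complexify hz
  have hfac := algebraMap_sub_complexify hsplit hz
  apply hmem
  rw [spectrum.mem_resolventSet_iff, hfac]
  refine (isUnit_one_sub_of_injective hK fun x y hxy ↦ ?_).mul hres
  have hbij := ContinuousLinearMap.isUnit_iff_bijective.1 hres
  obtain ⟨x, rfl⟩ := hbij.2 x
  obtain ⟨y, rfl⟩ := hbij.2 y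
  rw [← mul_apply_eq_comp, ← mul_apply_eq_comp, ← hfac, Algebra.algebraMap_eq_smul_one] at hxy
  rw [hinj hxy]

end Complexify

/-! ### Positive operators, the spectral radius and positive eigenvectors. -/

section Positive

open Filter Topology

variable {E : Type*} [MeasurableSpace E] {p : ℝ≥0∞} {μ : Measure E}

theorem Lp_smul_nonneg {c : ℝ} (hc : 0 ≤ c) {f : Lp ℝ p μ} (hf : 0 ≤ f) : 0 ≤ c • f := by
  rw [← Lp.coeFn_nonneg] at hf ⊢
  filter_upwards [hf, Lp.coeFn_smul c f] with x h1 h2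
  rw [h2]
  exact smul_nonneg hc h1

theorem Lp_smul_le_smul {c d : ℝ} (hcd : c ≤ d) {f : Lp ℝ p μ} (hf : 0 ≤ f) : c • f ≤ d • f := by
  rw [← sub_nonneg, ← sub_smul]
  exact Lp_smul_nonneg (sub_nonneg.2 hcd) hf

variable [Fact (1 ≤ p)]

/-- A nonzero nonnegative function is detected by a positive functional. -/
theorem exists_positiveFunctional_pos {f : Lp ℝ p μ} (hf : 0 ≤ f) (hf0 : f ≠ 0) :
    ∃ ψ : StrongDual ℝ (Lp ℝ p μ), IsPositiveFunctional ψ ∧ 0 < ψ f := by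
  let C : ProperCone ℝ (Lp ℝ p μ) :=
    { carrier := {g | 0 ≤ g}
      add_mem' := fun {a b} (ha : 0 ≤ a) (hb : 0 ≤ b) ↦ show 0 ≤ a + b from add_nonneg ha hb
      zero_mem' := le_refl (0 : Lp ℝ p μ)
      smul_mem' := fun c _ hg ↦ Lp_smul_nonneg c.2 hg
      isClosed' := isClosed_Ici }
  -- Separate `-f` from the closed positive cone.
  obtain ⟨ψ, hψ, hψf⟩ := C.hyperplane_separation_point (x₀ := -f)
    fun (h : 0 ≤ -f) ↦ hf0 (le_antisymm (neg_nonneg.1 h) hf)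
  exact ⟨ψ, fun g hg ↦ hψ g hg, by simpa using hψf⟩

theorem IsPositiveOp.pow {U : Lp ℝ p μ →L[ℝ] Lp ℝ p μ} (hU : IsPositiveOp U) (n : ℕ) :
    IsPositiveOp (U ^ n) := by
  induction n with
  | zero => exact fun f hf ↦ hf
  | succ n ih =>
    intro f hf
    rw [pow_succ, mul_apply_eq_comp]
    exact ih _ (hU f hf)

variable {U : Lp ℝ p μ →L[ℝ] Lp ℝ p μ}

/-- Ensures that the `toReal` in `specRadius` is not the default value 0 of `⊤`. -/
theorem spectralRadius_ne_top : spectralRadius ℂ (complexify U) ≠ ⊤ := by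
  have h : ∀ z ∈ spectrum ℂ (complexify U),
      ‖z‖₊ ≤ ‖complexify U‖₊ * ‖(1 : Lp ℂ p μ →L[ℂ] Lp ℂ p μ)‖₊ :=
    fun z hz ↦ spectrum.norm_le_norm_mul_of_mem hz
  exact ne_top_of_le_ne_top ENNReal.coe_ne_top
    (iSup₂_le fun z hz ↦ ENNReal.coe_le_coe.2 (h z hz))

theorem spectralRadius_lt {z : ℂ} (hz : specRadius U < ‖z‖) :
    spectralRadius ℂ (complexify U) < ‖z‖₊ := by
  have h := (ENNReal.lt_ofReal_iff_toReal_lt spectralRadius_ne_top).2 hz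
  rwa [ofReal_norm, enorm_eq_nnnorm] at h

theorem hasSum_resolvent_incl {z : ℂ} (hz : specRadius U < ‖z‖) (f : Lp ℝ p μ) :
    HasSum (fun n : ℕ ↦ z⁻¹ ^ (n + 1) • incl ((U ^ n) f))
      (resolvent (complexify U) z (incl f)) := by
  have h := (hasSum_resolvent (spectralRadius_lt hz)).mapL
    (ContinuousLinearMap.apply ℂ (Lp ℂ p μ) (incl f))
  simpa only [ContinuousLinearMap.apply_apply, smul_apply, complexify_pow, complexify_incl] using h

theorem hasSum_re_resolvent_incl {z : ℂ} (hz : specRadius U < ‖z‖) (f : Lp ℝ p μ) :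
    HasSum (fun n : ℕ ↦ (z⁻¹ ^ (n + 1)).re • (U ^ n) f)
      (re (resolvent (complexify U) z (incl f))) := by
  have h := (hasSum_resolvent_incl hz f).mapL re
  simpa only [re_smul, re_incl, im_incl, smul_zero, sub_zero] using h

theorem hasSum_im_resolvent_incl {z : ℂ} (hz : specRadius U < ‖z‖) (f : Lp ℝ p μ) :
    HasSum (fun n : ℕ ↦ (z⁻¹ ^ (n + 1)).im • (U ^ n) f)
      (im (resolvent (complexify U) z (incl f))) := by
  have h := (hasSum_resolvent_incl hz f).mapL im
  simpa only [im_smul, re_incl, im_incl, smul_zero, zero_add] using h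

theorem hasSum_re_resolvent_norm_incl {z : ℂ} (hz : specRadius U < ‖z‖) (f : Lp ℝ p μ) :
    HasSum (fun n : ℕ ↦ ‖z⁻¹ ^ (n + 1)‖ • (U ^ n) f)
      (re (resolvent (complexify U) (‖z‖ : ℂ) (incl f))) := by
  have h := hasSum_re_resolvent_incl (U := U) (z := (‖z‖ : ℂ)) (by simpa using hz) f
  have hc : ∀ n : ℕ, (((‖z‖ : ℂ))⁻¹ ^ (n + 1)).re = ‖z⁻¹ ^ (n + 1)‖ := fun n ↦ by
    rw [← Complex.ofReal_inv, ← Complex.ofReal_pow, Complex.ofReal_re, norm_pow, norm_inv]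
  simpa only [hc] using h

/-- For positive `U` and `f ≥ 0`, `‖(z - U)⁻¹ f‖` is controlled by `(|z| - U)⁻¹`. -/
theorem norm_resolvent_incl_le (hU : IsPositiveOp U) {z : ℂ} (hz : specRadius U < ‖z‖)
    {f : Lp ℝ p μ} (hf : 0 ≤ f) :
    ‖resolvent (complexify U) z (incl f)‖ ≤
      2 * (‖resolvent (complexify U) (‖z‖ : ℂ)‖ * ‖f‖) := by
  have hle : ‖re (resolvent (complexify U) (‖z‖ : ℂ) (incl f))‖ ≤
      ‖resolvent (complexify U) (‖z‖ : ℂ)‖ * ‖f‖ :=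
    (norm_re_le _).trans (((resolvent (complexify U) (‖z‖ : ℂ)).le_opNorm _).trans
      (mul_le_mul_of_nonneg_left (norm_incl_le f) (norm_nonneg _)))
  have hpos : ∀ n, 0 ≤ (U ^ n) f := fun n ↦ hU.pow n f hf
  -- For `c` the real or imaginary part, the Neumann series at `z` is dominated termwise by the one
  -- at `|z|`, because `U^n f ≥ 0`; the lattice norm is monotone.
  have hdom : ∀ (c : ℂ → ℝ) (g : Lp ℝ p μ), (∀ w, |c w| ≤ ‖w‖) →
      HasSum (fun n : ℕ ↦ c (z⁻¹ ^ (n + 1)) • (U ^ n) f) g →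
      ‖g‖ ≤ ‖re (resolvent (complexify U) (‖z‖ : ℂ) (incl f))‖ := by
    intro c g hc hg
    have hN := hasSum_re_resolvent_norm_incl hz f
    have h1 : g ≤ re (resolvent (complexify U) (‖z‖ : ℂ) (incl f)) :=
      hasSum_le (fun n ↦ Lp_smul_le_smul ((le_abs_self _).trans (hc _)) (hpos n)) hg hN
    have h2 : -g ≤ re (resolvent (complexify U) (‖z‖ : ℂ) (incl f)) :=
      hasSum_le (fun n ↦ by
        rw [← neg_smul]
        exact Lp_smul_le_smul ((neg_le_abs _).trans (hc _)) (hpos n)) hg.neg hN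
    exact norm_le_norm_of_abs_le_abs ((sup_le h1 h2).trans (le_abs_self _))
  have h1 := hdom _ _ Complex.abs_re_le_norm (hasSum_re_resolvent_incl hz f)
  have h2 := hdom _ _ Complex.abs_im_le_norm (hasSum_im_resolvent_incl hz f)
  have h3 := norm_le_re_add_im (resolvent (complexify U) z (incl f))
  linarith

theorem norm_posPart_le (f : Lp ℝ p μ) : ‖f⁺‖ ≤ ‖f‖ :=
  norm_le_norm_of_abs_le_abs (by
    rw [abs_of_nonneg (posPart_nonneg f)]
    exact sup_le (le_abs_self f) (abs_nonneg f))

theorem norm_negPart_le (f : Lp ℝ p μ) : ‖f⁻‖ ≤ ‖f‖ := by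
  rw [← posPart_neg, ← norm_neg f]
  exact norm_posPart_le (-f)

/-- `8 = 2 · 2 · 2`: the bound for `f ≥ 0`, then positive and negative parts, then real and
imaginary parts. -/
theorem norm_resolvent_le (hU : IsPositiveOp U) {z : ℂ} (hz : specRadius U < ‖z‖) :
    ‖resolvent (complexify U) z‖ ≤ 8 * ‖resolvent (complexify U) (‖z‖ : ℂ)‖ := by
  set R := resolvent (complexify U) z
  set C := ‖resolvent (complexify U) (‖z‖ : ℂ)‖
  have hC : 0 ≤ C := norm_nonneg _
  have hreal : ∀ g : Lp ℝ p μ, ‖R (incl g)‖ ≤ 4 * C * ‖g‖ := fun g ↦ by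
    have hg : R (incl g) = R (incl g⁺) - R (incl g⁻) := by
      rw [← map_sub, ← map_sub, posPart_sub_negPart]
    have h1 := norm_resolvent_incl_le hU hz (posPart_nonneg g)
    have h2 := norm_resolvent_incl_le hU hz (negPart_nonneg g)
    have h3 := mul_le_mul_of_nonneg_left (norm_posPart_le g) hC
    have h4 := mul_le_mul_of_nonneg_left (norm_negPart_le g) hC
    have h5 := norm_sub_le (R (incl g⁺)) (R (incl g⁻))
    rw [hg]
    linarith
  refine ContinuousLinearMap.opNorm_le_bound _ (by positivity) fun f ↦ ?_
  have hf : R f = R (incl (re f)) + Complex.I • R (incl (im f)) := by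
    rw [← map_smul, ← map_add, incl_re_add_im]
  have h1 := (hreal (re f)).trans (mul_le_mul_of_nonneg_left (norm_re_le f) (by positivity))
  have h2 := (hreal (im f)).trans (mul_le_mul_of_nonneg_left (norm_im_le f) (by positivity))
  have h3 := norm_add_le (R (incl (re f))) (Complex.I • R (incl (im f)))
  rw [norm_smul, Complex.norm_I, one_mul] at h3
  rw [hf]
  linarith

/-- The spectral radius of a positive operator belongs to its spectrum. -/
theorem specRadius_mem_spectrum (hU : IsPositiveOp U) (hr : 0 < specRadius U) :
    (specRadius U : ℂ) ∈ spectrum ℂ (complexify U) := by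
  set r := specRadius U with hrdef
  have hne : (spectrum ℂ (complexify U)).Nonempty := by
    rw [Set.nonempty_iff_ne_empty]
    intro he
    have : spectralRadius ℂ (complexify U) = 0 := by simp [spectralRadius, he]
    rw [hrdef, specRadius, this] at hr
    simp at hr
  obtain ⟨z₀, hz₀, hz₀r⟩ := spectrum.exists_nnnorm_eq_spectralRadius_of_nonempty hne
  have hnorm : ‖z₀‖ = r := by
    rw [hrdef, specRadius, ← hz₀r]; rfl
  -- Let `t ↓ 1`: the resolvent at `t z₀` must blow up since `z₀` is spectral, yet it is at most 8
  -- times the resolvent at `t r`, which stays bounded if `r` is a resolvent point.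
  by_contra hmem
  have hmem' : (r : ℂ) ∈ resolventSet ℂ (complexify U) := by
    by_contra h
    exact hmem h
  set C := ‖resolvent (complexify U) (r : ℂ)‖ + 1
  set one := ‖(1 : Lp ℂ p μ →L[ℂ] Lp ℂ p μ)‖
  have hcont : Tendsto (fun t : ℝ ↦ ‖resolvent (complexify U) ((t * r : ℝ) : ℂ)‖) (𝓝[>] 1)
      (𝓝 ‖resolvent (complexify U) (r : ℂ)‖) := by
    have h1 : Tendsto (fun t : ℝ ↦ ((t * r : ℝ) : ℂ)) (𝓝 1) (𝓝 (((1 : ℝ) * r : ℝ) : ℂ)) :=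
      Continuous.tendsto (by fun_prop) 1
    rw [one_mul] at h1
    exact (((analyticAt_resolvent hmem').continuousAt.tendsto.comp h1).norm).mono_left
      nhdsWithin_le_nhds
  have hsmall : Tendsto (fun t : ℝ ↦ 8 * C * ((t - 1) * r * one)) (𝓝[>] 1)
      (𝓝 (8 * C * ((1 - 1) * r * one))) :=
    (Continuous.tendsto (by fun_prop) (1 : ℝ)).mono_left nhdsWithin_le_nhds
  rw [sub_self, zero_mul, zero_mul, mul_zero] at hsmall
  obtain ⟨t, h1, h2, ht⟩ := ((hcont.eventually_lt_const (lt_add_one _)).and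
    ((hsmall.eventually_lt_const one_pos).and self_mem_nhdsWithin)).exists
  have ht1 : 1 < t := ht
  have hzt : ‖(t : ℂ) * z₀‖ = t * r := by
    rw [norm_mul, Complex.norm_real, Real.norm_of_nonneg (zero_le_one.trans ht1.le), hnorm]
  have hlt : specRadius U < ‖(t : ℂ) * z₀‖ := by
    rw [hzt]
    exact lt_mul_of_one_lt_left hr ht1
  have h3 := one_le_norm_resolvent_mul
    (spectrum.mem_resolventSet_of_spectralRadius_lt (spectralRadius_lt hlt)) hz₀
  have h4 := norm_resolvent_le hU hlt
  rw [hzt] at h4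
  have h5 : ‖z₀ - (t : ℂ) * z₀‖ = (t - 1) * r := by
    rw [← one_sub_mul, norm_mul, hnorm, norm_sub_rev, ← Complex.ofReal_one, ← Complex.ofReal_sub,
      Complex.norm_real, Real.norm_of_nonneg (by linarith)]
  rw [h5] at h3
  have h6 : 0 ≤ (t - 1) * r * one :=
    mul_nonneg (mul_nonneg (by linarith) hr.le) (norm_nonneg _)
  have h7 := h4.trans (mul_le_mul_of_nonneg_left h1.le (by norm_num : (0 : ℝ) ≤ 8))
  exact absurd (h3.trans (mul_le_mul_of_nonneg_right h7 h6)) (not_le.2 h2)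

/-- The leading coefficient of the resolvent at the spectral radius is a positive operator. -/
theorem leading_coeff_nonneg (hU : IsPositiveOp U) (hr : 0 < specRadius U) {k : ℕ}
    {Q : Lp ℂ p μ →L[ℂ] Lp ℂ p μ}
    (hQ : Tendsto (fun z ↦ (z - (specRadius U : ℂ)) ^ k • resolvent (complexify U) z)
      (𝓝[≠] (specRadius U : ℂ)) (𝓝 Q)) {f : Lp ℝ p μ} (hf : 0 ≤ f) :
    0 ≤ re (Q (incl f)) ∧ im (Q (incl f)) = 0 := by
  set r := specRadius U
  have hs : Tendsto (fun s : ℝ ↦ (s : ℂ)) (𝓝[>] r) (𝓝[≠] (r : ℂ)) := by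
    refine tendsto_nhdsWithin_iff.2 ⟨(Complex.continuous_ofReal.tendsto r).mono_left
      nhdsWithin_le_nhds, ?_⟩
    filter_upwards [self_mem_nhdsWithin] with s hs h
    exact (ne_of_gt hs) (Complex.ofReal_injective h)
  have hlim := ((ContinuousLinearMap.apply ℂ (Lp ℂ p μ) (incl f)).continuous.tendsto Q).comp
    (hQ.comp hs)
  -- At real `s > r` the Neumann coefficients are real and nonnegative, so approaching `r` from the
  -- right preserves positivity.
  have hval : ∀ s : ℝ, r < s →
      0 ≤ re (((s : ℂ) - r) ^ k • resolvent (complexify U) (s : ℂ) (incl f)) ∧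
      im (((s : ℂ) - r) ^ k • resolvent (complexify U) (s : ℂ) (incl f)) = 0 := by
    intro s hs
    have hspos : 0 < s := hr.trans hs
    have hsn : ‖(s : ℂ)‖ = s := by rw [Complex.norm_real, Real.norm_of_nonneg hspos.le]
    have hlt : specRadius U < ‖(s : ℂ)‖ := by rw [hsn]; exact hs
    have hcoef : ∀ n : ℕ, (s : ℂ)⁻¹ ^ (n + 1) = ((s⁻¹ ^ (n + 1) : ℝ) : ℂ) := fun n ↦ by
      push_cast; rfl
    have him : im (resolvent (complexify U) (s : ℂ) (incl f)) = 0 := by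
      refine (hasSum_im_resolvent_incl hlt f).unique ?_
      simp only [hcoef, Complex.ofReal_im, zero_smul]
      exact hasSum_zero
    have hre : 0 ≤ re (resolvent (complexify U) (s : ℂ) (incl f)) := by
      refine (hasSum_re_resolvent_incl hlt f).nonneg fun n ↦ ?_
      rw [hcoef, Complex.ofReal_re]
      exact Lp_smul_nonneg (by positivity) (hU.pow n f hf)
    have hc : ((s : ℂ) - r) ^ k = (((s - r) ^ k : ℝ) : ℂ) := by push_cast; rfl
    rw [hc, re_smul, im_smul, him, Complex.ofReal_re, Complex.ofReal_im]
    simp only [zero_smul, smul_zero, sub_zero, add_zero]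
    exact ⟨Lp_smul_nonneg (pow_nonneg (sub_nonneg.2 hs.le) k) hre, trivial⟩
  constructor
  · refine ge_of_tendsto ((re.continuous.tendsto _).comp hlim) ?_
    filter_upwards [self_mem_nhdsWithin] with s hs using (hval s hs).1
  · refine tendsto_nhds_unique ((im.continuous.tendsto _).comp hlim)
      (tendsto_const_nhds.congr' ?_)
    filter_upwards [self_mem_nhdsWithin] with s hs using (hval s hs).2.symm

/-- Nonnegative functions span the complex space. -/
theorem exists_nonneg_apply_incl_ne_zero {Q : Lp ℂ p μ →L[ℂ] Lp ℂ p μ} (hQ : Q ≠ 0) :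
    ∃ f : Lp ℝ p μ, 0 ≤ f ∧ Q (incl f) ≠ 0 := by
  by_contra! h
  apply hQ
  have hreal : ∀ g : Lp ℝ p μ, Q (incl g) = 0 := fun g ↦ by
    rw [← posPart_sub_negPart g, map_sub, map_sub, h _ (posPart_nonneg g), h _ (negPart_nonneg g),
      sub_zero]
  ext1 f
  rw [← incl_re_add_im f, map_add, map_smul, hreal, hreal, smul_zero, add_zero, zero_apply]

/-- A positive operator whose spectral radius is a pole of the resolvent has a positive
eigenfunction and a positive eigenfunctional. -/
theorem exists_positive_eigenvectors (hU : IsPositiveOp U) (hr : 0 < specRadius U)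
    (hfin : InvertibleModFiniteRank
      (algebraMap ℂ (Lp ℂ p μ →L[ℂ] Lp ℂ p μ) (specRadius U : ℂ) - complexify U))
    (hiso : ∀ᶠ z in 𝓝[≠] (specRadius U : ℂ), z ∈ resolventSet ℂ (complexify U)) :
    ∃ (f₀ : Lp ℝ p μ) (φ₀ : StrongDual ℝ (Lp ℝ p μ)),
      0 ≤ f₀ ∧ f₀ ≠ 0 ∧ IsPositiveFunctional φ₀ ∧ φ₀ ≠ 0 ∧
      U f₀ = specRadius U • f₀ ∧ dualOp U φ₀ = specRadius U • φ₀ := by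
  obtain ⟨k, Q, hQ0, hQ, hUQ, hQU⟩ :=
    exists_leading_coeff hfin (specRadius_mem_spectrum hU hr) hiso
  have hre : ∀ g : Lp ℂ p μ, re ((specRadius U : ℂ) • g) = specRadius U • re g := fun g ↦ by
    rw [re_smul, Complex.ofReal_re, Complex.ofReal_im, zero_smul, sub_zero]
  obtain ⟨f, hf, hQf⟩ := exists_nonneg_apply_incl_ne_zero hQ0
  obtain ⟨h1, h2⟩ := leading_coeff_nonneg hU hr hQ hf
  have hne : re (Q (incl f)) ≠ 0 := fun h ↦ hQf (ext_re_im (by rw [h, map_zero])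
    (by rw [h2, map_zero]))
  obtain ⟨ψ, hψ, hψf⟩ := exists_positiveFunctional_pos h1 hne
  -- `QU = r(U)Q` makes `ψ ∘ Q` an eigenfunctional; it is nonzero because its value at `f` is `ψ(f₀)
  -- > 0`.
  let φ₀ : StrongDual ℝ (Lp ℝ p μ) := ψ ∘L re ∘L (Q.restrictScalars ℝ) ∘L incl
  have hφ₀ : ∀ g, φ₀ g = ψ (re (Q (incl g))) := fun _ ↦ rfl
  refine ⟨re (Q (incl f)), φ₀, h1, hne, fun g hg ↦ hψ _ (leading_coeff_nonneg hU hr hQ hg).1,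
    fun h ↦ ?_, ?_, ?_⟩
  · rw [← hφ₀, h, zero_apply] at hψf
    exact lt_irrefl _ hψf
  · rw [← re_complexify, hUQ, hre]
  · ext g
    change φ₀ (U g) = specRadius U • φ₀ g
    rw [hφ₀, hφ₀, ← complexify_incl, hQU, hre, map_smul]

end Positive

end PosLp

/-! ### Assembly of the theorem. -/

theorem theorem2p1 {E : Type*} [MeasurableSpace E] (μ : Measure E) [SigmaFinite μ]
    (p : ℝ≥0∞) [Fact (1 ≤ p)] (hp : p ≠ ∞)
    (U W K : Lp ℝ p μ →L[ℝ] Lp ℝ p μ)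
    (hU : PosLp.IsPositiveOp U) (hr : 0 < PosLp.specRadius U)
    (hsplit : U = W + K) (hW : ‖W‖ < PosLp.specRadius U)
    (hK : ∀ z : ℂ, ‖W‖ < ‖z‖ →
      PosLp.IsPowerCompact (PosLp.complexify K * resolvent (PosLp.complexify W) z)) :
    (∃ (f₀ : Lp ℝ p μ) (φ₀ : StrongDual ℝ (Lp ℝ p μ)),
      0 ≤ f₀ ∧ f₀ ≠ 0 ∧ PosLp.IsPositiveFunctional φ₀ ∧ φ₀ ≠ 0 ∧
      U f₀ = PosLp.specRadius U • f₀ ∧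
      PosLp.dualOp U φ₀ = PosLp.specRadius U • φ₀) ∧
    (∀ κ : ℝ, ‖W‖ < κ → κ < PosLp.specRadius U →
      (spectrum ℂ (PosLp.complexify U) ∩ {z : ℂ | κ ≤ ‖z‖}).Finite ∧
      spectrum ℂ (PosLp.complexify U) ∩ {z : ℂ | κ ≤ ‖z‖} ⊆
        PosLp.pointSpectrum (PosLp.complexify U)) := by
  have hfin : ∀ z : ℂ, ‖W‖ < ‖z‖ → PosLp.InvertibleModFiniteRank
      (algebraMap ℂ (Lp ℂ p μ →L[ℂ] Lp ℂ p μ) z - PosLp.complexify U) :=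
    fun z hz ↦ PosLp.invertibleModFiniteRank hsplit hz (hK z hz)
  have hrW : ‖W‖ < ‖(PosLp.specRadius U : ℂ)‖ := by
    rwa [Complex.norm_real, Real.norm_of_nonneg hr.le]
  refine ⟨PosLp.exists_positive_eigenvectors hU hr (hfin _ hrW)
    (PosLp.eventually_mem_resolventSet (norm_nonneg W) hfin hrW), fun κ hκ _ ↦
    ⟨PosLp.finite_spectrum_inter (norm_nonneg W) hκ hfin, fun z hz ↦ ?_⟩⟩
  have hz' : ‖W‖ < ‖z‖ := hκ.trans_le hz.2
  exact PosLp.mem_pointSpectrum hsplit hz' (hK z hz') hz.1
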